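/- Let $A(x)=\frac1{2\pi}\int_{-\infty}^{\infty}e^{it^3/3}e^{itx}\,dt$ be the Airy function, where the integral is the limit of $\int_a^b$ as $a\to-\infty$ and $b\to\infty$ independently. Let $f:\mathbb R\to\mathbb C$ be a Schwartz function and let $\alpha>0$. Then the integral defining $A(x)$ converges for every $x\in\mathbb R$, the integral $\int_0^\infty A(x+z)A(z+y)\,dz$ converges absolutely for all $x,y\in\mathbb R$, and the Airy operator $A_\alpha(f)$, that is, the integral operator on $L^2(\mathbb R)$ with kernel $$K(x,y)=f(x/\alpha)\int_0^\infty A(x+z)\,A(z+y)\,dz,$$ is a well-defined bounded operator and is trace class. Explicitly, there is a bounded linear operator $T$ on the complex Hilbert space $L^2(\mathbb R)$ such that for every $g\in L^2(\mathbb R)$ and almost every $x$ the integral $\int_{\mathbb R}K(x,y)g(y)\,dy$ converges absolutely and equals $(Tg)(x)$, and $\sum_i\langle e_i,|T|e_i\rangle<\infty$ for every orthonormal basis $(e_i)$ of $L^2(\mathbb R)$, where $|T|=(T^*T)^{1/2}$. -/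

import Mathlib

open Filter Topology MeasureTheory
open scoped SchwartzMap

noncomputable section

universe u

/-- The truncated integral `(1 / 2π) ∫_a^b e^{i t³ / 3} e^{i t x} dt`, where `p = (a, b)`. -/
def airyTruncated (x : ℝ) (p : ℝ × ℝ) : ℂ :=
  1 / (2 * (Real.pi : ℂ)) *
    ∫ t in p.1..p.2,
      Complex.exp (Complex.I * (t : ℂ) ^ 3 / 3) * Complex.exp (Complex.I * (t : ℂ) * (x : ℂ))

/-- The Airy function `A(x) = (1 / 2π) ∫_{-∞}^{∞} e^{i t³ / 3} e^{i t x} dt`.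
The integrand has modulus `1`, so this is an improper (conditionally convergent) integral: the
limit of the truncated integrals as `a → -∞` and `b → ∞` independently. -/
def airyA (x : ℝ) : ℂ :=
  limUnder (atBot ×ˢ atTop) (airyTruncated x)

/-- The kernel `f(x / α) ∫_0^∞ A(x + z) A(z + y) dz` of the Airy operator with symbol `f`. -/
def airyKernel (α : ℝ) (f : ℝ → ℂ) (x y : ℝ) : ℂ :=
  f (x / α) * ∫ z in Set.Ioi (0 : ℝ), airyA (x + z) * airyA (z + y)

/-- The bounded operator `T` on `L²(ℝ)` is the integral operator with kernel `k`: for every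
`g ∈ L²(ℝ)` and almost every `x`, the integral `∫ k(x, y) g(y) dy` converges absolutely and equals
`(T g)(x)`. Such a `T` is determined by `k`. -/
def IsIntegralOperator (k : ℝ → ℝ → ℂ)
    (T : Lp ℂ 2 (volume : Measure ℝ) →L[ℂ] Lp ℂ 2 (volume : Measure ℝ)) : Prop :=
  ∀ g : Lp ℂ 2 (volume : Measure ℝ), ∀ᵐ x : ℝ,
    Integrable (fun y : ℝ => k x y * g y) ∧ T g x = ∫ y : ℝ, k x y * g y

/-- A bounded operator `T` on a complex Hilbert space is trace class if `∑ ⟨e, |T| e⟩ < ∞` over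
each orthonormal (Hilbert) basis, where `|T| = (T* T)^{1/2}`. -/
def IsTraceClass {H : Type u} [NormedAddCommGroup H] [InnerProductSpace ℂ H] [CompleteSpace H]
    (T : H →L[ℂ] H) : Prop :=
  ∀ (ι : Type u) (b : HilbertBasis ι ℂ H),
    Summable fun i : ι => inner ℂ (b i) (CFC.abs T (b i))

end

/-! The operator is a product of two Hilbert–Schmidt operators, hence trace class. Write `P(u, y) =
∫_0^∞ A(u+z) A(z+y) dz`, `φ(x) = f(x/α)` and `ψ(u) = (1+u²) φ(u)`. Since `ψ P(·, y)` vanishes at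
`-∞`, it is the integral of its derivative over `(-∞, x]`, and `φ P` factors as the kernel `1_{u ≤
x} (1+x²)⁻¹ (1+u²)⁻¹` composed with `(1+u²) ∂_u[ψ(u) P(u, y)]`
(`integral_weightedPrimitiveKernel_mul`). The first factor is plainly square integrable.

For the second, `P(u, ·)` and `∂_u P(u, ·)` must lie in `L²(ℝ)` with norms growing at most
polynomially in `u`; the Schwartz factor absorbs the growth. Both are Airy transforms, `h ↦ ∫_0^∞
h(z) A(z+y) dz`, of translates of `A` and `A'`. The transform is a contraction from `L²(0, ∞)` to
`L²(ℝ)` because, up to a regularisation, it is two inverse Fourier transforms separated by a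
unimodular multiplier (`eLpNorm_airyTransform_le`). The translates have polynomially growing norms
by pointwise bounds obtained on shifting the Airy contour to height `1/(1+|u|)`
(`norm_airyA_add_le`, `norm_deriv_airyA_add_le`). -/

open scoped ENNReal FourierTransform

/-! ### Hilbert–Schmidt sums and trace class products -/

section TraceClass

variable {H : Type*} [NormedAddCommGroup H] [InnerProductSpace ℂ H]

/-- The square of the Hilbert–Schmidt norm of `T`, computed in the basis `b`. -/
noncomputable def hilbertSchmidtSq {ι : Type*} (b : HilbertBasis ι ℂ H) (T : H →L[ℂ] H) : ℝ≥0∞ :=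
  ∑' i, ‖T (b i)‖ₑ ^ 2

theorem HilbertBasis.tsum_enorm_inner_sq {ι : Type*} (b : HilbertBasis ι ℂ H) (x : H) :
    ∑' i, ‖inner ℂ (b i) x‖ₑ ^ 2 = ‖x‖ₑ ^ 2 := by
  have h := b.hasSum_inner_mul_inner x x
  have h2 : HasSum (fun i => ‖inner ℂ (b i) x‖ ^ 2) (‖x‖ ^ 2) := by
    have h3 := h.mapL Complex.reCLM
    have h4 : Complex.reCLM (inner ℂ x x) = ‖x‖ ^ 2 := by
      rw [inner_self_eq_norm_sq_to_K]
      simp [← Complex.ofReal_pow]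
    rw [h4] at h3
    refine h3.congr_fun ?_
    intro i
    rw [← inner_conj_symm x (b i), ← Complex.normSq_eq_conj_mul_self]
    rw [Complex.normSq_eq_norm_sq, Complex.reCLM_apply, Complex.ofReal_re]
  have h5 : ∀ r : H, ‖r‖ₑ ^ 2 = ENNReal.ofReal (‖r‖ ^ 2) := fun r => by
    rw [ENNReal.ofReal_pow (norm_nonneg _), ofReal_norm]
  have h6 : ∀ r : ℂ, ‖r‖ₑ ^ 2 = ENNReal.ofReal (‖r‖ ^ 2) := fun r => by
    rw [ENNReal.ofReal_pow (norm_nonneg _), ofReal_norm]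
  simp_rw [h5, h6]
  rw [← ENNReal.ofReal_tsum_of_nonneg (fun _ => by positivity) h2.summable, h2.tsum_eq]

theorem hilbertSchmidtSq_comp_le {ι : Type*} (b : HilbertBasis ι ℂ H) (D T : H →L[ℂ] H)
    (hD : ‖D‖ ≤ 1) : hilbertSchmidtSq b (D ∘L T) ≤ hilbertSchmidtSq b T := by
  refine ENNReal.tsum_le_tsum fun i => ?_
  gcongr
  rw [enorm_le_iff_norm_le]
  calc ‖D (T (b i))‖ ≤ ‖D‖ * ‖T (b i)‖ := D.le_opNorm _
    _ ≤ 1 * ‖T (b i)‖ := by gcongr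
    _ = _ := one_mul _

variable [CompleteSpace H]

/-- By Parseval both sides are the double sum of squared matrix entries, with the order of summation
exchanged. -/
theorem hilbertSchmidtSq_adjoint {ι : Type*} (b : HilbertBasis ι ℂ H) (T : H →L[ℂ] H) :
    hilbertSchmidtSq b (ContinuousLinearMap.adjoint T) = hilbertSchmidtSq b T := by
  unfold hilbertSchmidtSq
  simp_rw [← b.tsum_enorm_inner_sq]
  rw [ENNReal.tsum_comm]
  refine tsum_congr fun i => tsum_congr fun j => ?_
  rw [ContinuousLinearMap.adjoint_inner_right, ← ofReal_norm, ← ofReal_norm, norm_inner_symm]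

/-- An approximate polar decomposition. -/
theorem exists_contraction_comp_near_abs (T : H →L[ℂ] H) {ε : ℝ} (hε : 0 < ε) :
    ∃ D : H →L[ℂ] H, ‖D‖ ≤ 1 ∧ ‖D * T - CFC.abs T‖ ≤ ε := by
  set R := CFC.abs T with hR
  have hR0 : 0 ≤ R := CFC.abs_nonneg T
  have hRs : IsSelfAdjoint R := hR0.isSelfAdjoint
  have hRR : R * R = star T * T := CFC.abs_mul_abs T
  have hsp : ∀ x ∈ spectrum ℝ R, 0 ≤ x := fun x hx => spectrum_nonneg_of_nonneg hR0 hx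
  have hc : ContinuousOn (fun x : ℝ => (x + ε)⁻¹) (spectrum ℝ R) := by
    refine ContinuousOn.inv₀ (by fun_prop) fun x hx => ?_
    have := hsp x hx
    positivity
  set G := cfc (fun x : ℝ => (x + ε)⁻¹) R with hG
  have hGs : star G = G := (cfc_predicate (R := ℝ) (p := IsSelfAdjoint) _ R).star_eq
  have hid : R = cfc (fun x : ℝ => x) R := (cfc_id' ℝ R).symm
  have hGRR : G * (R * R) = cfc (fun x : ℝ => (x + ε)⁻¹ * (x * x)) R := by
    rw [cfc_mul _ _ R hc (by fun_prop), cfc_mul _ _ R (by fun_prop) (by fun_prop), ← hid]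
  -- `D = (R + ε)⁻¹ T*` stands in for the adjoint of the polar isometry: `D D* = R² / (R + ε)²` is
  -- at most `1`, and `R - D T = ε R / (R + ε)` is at most `ε`.
  refine ⟨G * star T, ?_, ?_⟩
  · have h1 : ‖G * star T‖ * ‖G * star T‖ ≤ 1 := by
      rw [← CStarRing.norm_self_mul_star (x := G * star T)]
      have : G * star T * star (G * star T)
          = cfc (fun x : ℝ => (x + ε)⁻¹ * (x * x) * (x + ε)⁻¹) R := by
        rw [star_mul, star_star, hGs, cfc_mul _ _ R (by fun_prop) hc, ← hGRR, hRR]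
        simp only [mul_assoc]
        rfl
      rw [this]
      refine norm_cfc_le zero_le_one fun x hx => ?_
      have hx0 := hsp x hx
      rw [Real.norm_of_nonneg (by positivity)]
      rw [show (x + ε)⁻¹ * (x * x) * (x + ε)⁻¹ = (x / (x + ε)) ^ 2 by field_simp]
      have : x / (x + ε) ≤ 1 := by rw [div_le_one (by positivity)]; linarith
      exact pow_le_one₀ (by positivity) this
    nlinarith [norm_nonneg (G * star T)]
  · have : G * star T * T - R = cfc (fun x : ℝ => (x + ε)⁻¹ * (x * x) - x) R := by
      rw [mul_assoc, ← hRR, hGRR, cfc_sub _ _ R (by fun_prop) (by fun_prop), ← hid]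
    rw [this]
    refine norm_cfc_le hε.le fun x hx => ?_
    have hx0 := hsp x hx
    have hp : 0 < x + ε := by positivity
    rw [show (x + ε)⁻¹ * (x * x) - x = -(ε * (x / (x + ε))) by field_simp; ring, norm_neg,
      Real.norm_of_nonneg (by positivity)]
    have : x / (x + ε) ≤ 1 := by rw [div_le_one (by positivity)]; linarith
    nlinarith

/-- Replacing `|BC|` by `DBC` with a contraction `D` turns each diagonal entry into `⟨(DB)* b_i, C
b_i⟩`, which is controlled by squared norms; the adjoint and the contraction do not increase the
Hilbert–Schmidt sum of `B`. -/
theorem sum_norm_inner_abs_comp_le {ι : Type*} (b : HilbertBasis ι ℂ H) (B C : H →L[ℂ] H)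
    (hB : hilbertSchmidtSq b B ≠ ∞) (hC : hilbertSchmidtSq b C ≠ ∞) (s : Finset ι) :
    ∑ i ∈ s, ‖inner ℂ (b i) (CFC.abs (B ∘L C) (b i))‖ ≤
      (hilbertSchmidtSq b B).toReal + (hilbertSchmidtSq b C).toReal := by
  have key : ∀ (E : H →L[ℂ] H), hilbertSchmidtSq b E ≠ ∞ →
      ∑ i ∈ s, ‖E (b i)‖ ^ 2 ≤ (hilbertSchmidtSq b E).toReal := by
    intro E hE
    have h1 : ∑ i ∈ s, ‖E (b i)‖ₑ ^ 2 ≤ hilbertSchmidtSq b E := ENNReal.sum_le_tsum s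
    have h2 := ENNReal.toReal_mono hE h1
    rw [ENNReal.toReal_sum (fun i _ => by simp)] at h2
    simpa using h2
  refine le_of_forall_pos_le_add fun δ hδ => ?_
  -- The error occurs once per element of `s`, so it totals at most `δ`; the `+ 1` covers empty `s`.
  obtain ⟨D, hD, hDT⟩ := exists_contraction_comp_near_abs (B ∘L C)
    (ε := δ / (s.card + 1)) (by positivity)
  set A := ContinuousLinearMap.adjoint (D ∘L B)
  have hA : hilbertSchmidtSq b A ≤ hilbertSchmidtSq b B :=
    (hilbertSchmidtSq_adjoint b _).trans_le (hilbertSchmidtSq_comp_le b D B hD)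
  have hA' : hilbertSchmidtSq b A ≠ ∞ := (hA.trans_lt hB.lt_top).ne
  have hAr : (hilbertSchmidtSq b A).toReal ≤ (hilbertSchmidtSq b B).toReal :=
    ENNReal.toReal_mono hB hA
  have hterm : ∀ i, ‖inner ℂ (b i) (CFC.abs (B ∘L C) (b i))‖
      ≤ ‖A (b i)‖ ^ 2 + ‖C (b i)‖ ^ 2 + δ / (s.card + 1) := by
    intro i
    have hbi : ‖b i‖ = 1 := b.orthonormal.1 i
    have h1 : CFC.abs (B ∘L C) (b i) = (D ∘L B) (C (b i))
        - (D * (B ∘L C) - CFC.abs (B ∘L C)) (b i) := by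
      simp
    rw [h1, inner_sub_right]
    have h2 : ‖inner ℂ (b i) ((D ∘L B) (C (b i)))‖ ≤ ‖A (b i)‖ ^ 2 + ‖C (b i)‖ ^ 2 := by
      rw [← ContinuousLinearMap.adjoint_inner_left]
      refine (norm_inner_le_norm _ _).trans ?_
      change ‖A (b i)‖ * _ ≤ _
      nlinarith [sq_nonneg (‖A (b i)‖ - ‖C (b i)‖), sq_nonneg (‖A (b i)‖),
        sq_nonneg ‖C (b i)‖]
    have h3 : ‖inner ℂ (b i) ((D * (B ∘L C) - CFC.abs (B ∘L C)) (b i))‖ ≤ δ / (s.card + 1) := by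
      refine (norm_inner_le_norm _ _).trans ?_
      rw [hbi, one_mul]
      refine (ContinuousLinearMap.le_opNorm _ _).trans ?_
      rw [hbi, mul_one]
      exact hDT
    exact (norm_sub_le _ _).trans (add_le_add h2 h3)
  calc ∑ i ∈ s, ‖inner ℂ (b i) (CFC.abs (B ∘L C) (b i))‖
      ≤ ∑ i ∈ s, (‖A (b i)‖ ^ 2 + ‖C (b i)‖ ^ 2 + δ / (s.card + 1)) :=
        Finset.sum_le_sum fun i _ => hterm i
    _ = ∑ i ∈ s, ‖A (b i)‖ ^ 2 + ∑ i ∈ s, ‖C (b i)‖ ^ 2 + s.card * (δ / (s.card + 1)) := by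
        rw [Finset.sum_add_distrib, Finset.sum_add_distrib, Finset.sum_const, nsmul_eq_mul]
    _ ≤ (hilbertSchmidtSq b B).toReal + (hilbertSchmidtSq b C).toReal + δ := by
        refine add_le_add (add_le_add ((key A hA').trans hAr) (key C hC)) ?_
        rw [mul_div_assoc', div_le_iff₀ (by positivity)]
        nlinarith

end TraceClass

/-- A product of two Hilbert–Schmidt operators is trace class. -/
theorem isTraceClass_comp {H : Type u} [NormedAddCommGroup H] [InnerProductSpace ℂ H]
    [CompleteSpace H] (B C : H →L[ℂ] H)
    (hB : ∀ (ι : Type u) (b : HilbertBasis ι ℂ H), hilbertSchmidtSq b B ≠ ∞)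
    (hC : ∀ (ι : Type u) (b : HilbertBasis ι ℂ H), hilbertSchmidtSq b C ≠ ∞) :
    IsTraceClass (B ∘L C) := fun ι b =>
  .of_norm <| summable_of_sum_le (fun _ => norm_nonneg _)
    fun s => sum_norm_inner_abs_comp_le b B C (hB ι b) (hC ι b) s

/-! ### Integral operators with square integrable kernels -/

section Kernel

variable {X : Type*} [MeasurableSpace X] {μ : Measure X}

theorem MeasureTheory.Lp.enorm_sq_eq_lintegral (g : Lp ℂ 2 μ) :
    ‖g‖ₑ ^ 2 = ∫⁻ x, ‖g x‖ₑ ^ 2 ∂μ := by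
  rw [Lp.enorm_def, eLpNorm_eq_lintegral_rpow_enorm_toReal (by simp) (by simp), ← ENNReal.rpow_natCast,
    ← ENNReal.rpow_mul]
  simp

theorem MeasureTheory.memLp_two_iff_lintegral {h : X → ℂ} (hm : AEStronglyMeasurable h μ) :
    MemLp h 2 μ ↔ ∫⁻ x, ‖h x‖ₑ ^ 2 ∂μ < ∞ := by
  have := eLpNorm_lt_top_iff_lintegral_rpow_enorm_lt_top (f := h) (μ := μ) (p := 2) (by simp) (by simp)
  simp only [ENNReal.toReal_ofNat, ENNReal.rpow_ofNat] at this
  exact ⟨fun h => this.1 h.2, fun h => ⟨hm, this.2 h⟩⟩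

/-- Integration against a square integrable function is an inner product. -/
theorem MeasureTheory.MemLp.exists_inner_eq_integral_mul {h : X → ℂ} (hh : MemLp h 2 μ) :
    ∃ κ : Lp ℂ 2 μ, ‖κ‖ₑ ^ 2 = ∫⁻ x, ‖h x‖ₑ ^ 2 ∂μ ∧ ∀ g : Lp ℂ 2 μ,
      Integrable (fun x => h x * g x) μ ∧ ∫ x, h x * g x ∂μ = inner ℂ κ g := by
  have hs : MemLp (fun x => (starRingEnd ℂ) (h x)) 2 μ := hh.star
  have hae := hs.coeFn_toLp
  refine ⟨hs.toLp _, ?_, fun g => ⟨?_, ?_⟩⟩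
  · rw [Lp.enorm_sq_eq_lintegral]
    refine lintegral_congr_ae ?_
    filter_upwards [hae] with x hx
    rw [hx, ← ofReal_norm, ← ofReal_norm, RCLike.norm_conj]
  · exact MemLp.integrable_mul hh (Lp.memLp g)
  · rw [L2.inner_def]
    refine integral_congr_ae ?_
    filter_upwards [hae] with x hx
    rw [hx]
    simp [mul_comm]

variable [SFinite μ]

theorem MeasureTheory.MemLp.ae_memLp_prodMk {k : X × X → ℂ} (hk : MemLp k 2 (μ.prod μ)) :
    ∀ᵐ x ∂μ, MemLp (fun y => k (x, y)) 2 μ := by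
  have h1 := (memLp_two_iff_lintegral hk.1).1 hk
  rw [lintegral_prod _ (by exact hk.1.enorm.pow_const 2)] at h1
  have h2 := ae_lt_top' (AEMeasurable.lintegral_prod_right' (hk.1.enorm.pow_const 2)) h1.ne
  filter_upwards [h2, hk.1.prodMk_left] with x hx hm
  exact (memLp_two_iff_lintegral hm).2 hx

theorem MeasureTheory.MemLp.lintegral_enorm_integral_mul_sq_le {k : X × X → ℂ}
    (hk : MemLp k 2 (μ.prod μ)) (g : Lp ℂ 2 μ) :
    ∫⁻ x, ‖∫ y, k (x, y) * g y ∂μ‖ₑ ^ 2 ∂μ ≤ (eLpNorm k 2 (μ.prod μ)) ^ 2 * ‖g‖ₑ ^ 2 := by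
  have h1 : (eLpNorm k 2 (μ.prod μ)) ^ 2 = ∫⁻ x, ∫⁻ y, ‖k (x, y)‖ₑ ^ 2 ∂μ ∂μ := by
    rw [eLpNorm_eq_lintegral_rpow_enorm_toReal (by simp) (by simp), ← ENNReal.rpow_natCast,
      ← ENNReal.rpow_mul]
    simp [lintegral_prod _ (show AEMeasurable (fun p => ‖k p‖ₑ ^ 2) _ from hk.1.enorm.pow_const 2)]
  rw [h1, ← lintegral_mul_const'' _ (AEMeasurable.lintegral_prod_right' (hk.1.enorm.pow_const 2))]
  refine lintegral_mono_ae ?_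
  filter_upwards [hk.ae_memLp_prodMk] with x hx
  obtain ⟨κ, hκ, hg⟩ := hx.exists_inner_eq_integral_mul
  rw [← hκ, (hg g).2, ← mul_pow]
  gcongr
  rw [← ofReal_norm, ← ofReal_norm, ← ofReal_norm, ← ENNReal.ofReal_mul (norm_nonneg _)]
  exact ENNReal.ofReal_le_ofReal (norm_inner_le_norm _ _)

theorem MeasureTheory.MemLp.memLp_integral_mul {k : X × X → ℂ}
    (hk : MemLp k 2 (μ.prod μ)) (g : Lp ℂ 2 μ) :
    MemLp (fun x => ∫ y, k (x, y) * g y ∂μ) 2 μ := by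
  have hm : AEStronglyMeasurable (fun x => ∫ y, k (x, y) * g y ∂μ) μ := by
    refine AEStronglyMeasurable.integral_prod_right' (f := fun p : X × X => k p * g p.2) ?_
    exact hk.1.mul (Lp.aestronglyMeasurable g).comp_snd
  refine (memLp_two_iff_lintegral hm).2 ((hk.lintegral_enorm_integral_mul_sq_le g).trans_lt ?_)
  exact ENNReal.mul_lt_top (ENNReal.pow_lt_top hk.2) (by simp)

/-- The Hilbert–Schmidt operator on `L²` with a given square integrable kernel. -/
noncomputable def kernelOperator (k : X × X → ℂ) (hk : MemLp k 2 (μ.prod μ)) :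
    Lp ℂ 2 μ →L[ℂ] Lp ℂ 2 μ :=
  LinearMap.mkContinuous
    { toFun := fun g => (hk.memLp_integral_mul g).toLp _
      map_add' := fun g h => by
        rw [← MemLp.toLp_add]
        refine (MemLp.toLp_eq_toLp_iff _ _).2 ?_
        filter_upwards [hk.ae_memLp_prodMk] with x hx
        obtain ⟨κ, -, hκ⟩ := hx.exists_inner_eq_integral_mul
        rw [Pi.add_apply, (hκ _).2, (hκ _).2, (hκ _).2, inner_add_right]
      map_smul' := fun c g => by
        rw [RingHom.id_apply, ← MemLp.toLp_const_smul]
        refine (MemLp.toLp_eq_toLp_iff _ _).2 ?_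
        filter_upwards [hk.ae_memLp_prodMk] with x hx
        obtain ⟨κ, -, hκ⟩ := hx.exists_inner_eq_integral_mul
        rw [Pi.smul_apply, (hκ _).2, (hκ _).2, inner_smul_right, smul_eq_mul] }
    (eLpNorm k 2 (μ.prod μ)).toReal (fun g => by
      have h1 : ‖(hk.memLp_integral_mul g).toLp _‖ₑ ^ 2 ≤ (eLpNorm k 2 (μ.prod μ) * ‖g‖ₑ) ^ 2 := by
        rw [Lp.enorm_sq_eq_lintegral, mul_pow]
        refine le_trans (le_of_eq (lintegral_congr_ae ?_)) (hk.lintegral_enorm_integral_mul_sq_le g)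
        filter_upwards [(hk.memLp_integral_mul g).coeFn_toLp] with x hx
        rw [hx]
      have h2 := (ENNReal.pow_le_pow_left_iff two_ne_zero).1 h1
      have h3 := ENNReal.toReal_mono (ENNReal.mul_ne_top hk.2.ne (by simp)) h2
      rw [ENNReal.toReal_mul] at h3
      simpa using h3)

theorem kernelOperator_coeFn (k : X × X → ℂ) (hk : MemLp k 2 (μ.prod μ)) (g : Lp ℂ 2 μ) :
    kernelOperator k hk g =ᵐ[μ] fun x => ∫ y, k (x, y) * g y ∂μ :=
  (hk.memLp_integral_mul g).coeFn_toLp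

/-- Almost every row `k(x, ·)` is in `L²`, and Bessel's inequality bounds the sum of its squared
coefficients by its squared norm; then integrate in `x`. -/
theorem hilbertSchmidtSq_kernelOperator_ne_top (k : X × X → ℂ) (hk : MemLp k 2 (μ.prod μ))
    {ι : Type*} (b : HilbertBasis ι ℂ (Lp ℂ 2 μ)) :
    hilbertSchmidtSq b (kernelOperator k hk) ≠ ∞ := by
  have h1 := (memLp_two_iff_lintegral hk.1).1 hk
  rw [lintegral_prod _ (by exact hk.1.enorm.pow_const 2)] at h1
  refine (lt_of_le_of_lt ?_ h1).ne
  unfold hilbertSchmidtSq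
  -- The index set is not assumed countable, so sum and integral are exchanged on finite partial
  -- sums only.
  rw [ENNReal.tsum_eq_iSup_sum]
  refine iSup_le fun s => ?_
  have h2 : ∀ i, ‖kernelOperator k hk (b i)‖ₑ ^ 2 = ∫⁻ x, ‖∫ y, k (x, y) * b i y ∂μ‖ₑ ^ 2 ∂μ := by
    intro i
    rw [Lp.enorm_sq_eq_lintegral]
    refine lintegral_congr_ae ?_
    filter_upwards [kernelOperator_coeFn k hk (b i)] with x hx
    rw [hx]
  simp_rw [h2]
  rw [← lintegral_finsetSum' _ fun i _ => by
    exact ((hk.memLp_integral_mul (b i)).1.enorm.pow_const 2)]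
  refine lintegral_mono_ae ?_
  filter_upwards [hk.ae_memLp_prodMk] with x hx
  obtain ⟨κ, hκ, hg⟩ := hx.exists_inner_eq_integral_mul
  rw [← hκ, ← b.tsum_enorm_inner_sq]
  refine le_trans (le_of_eq (Finset.sum_congr rfl fun i _ => ?_)) (ENNReal.sum_le_tsum s)
  rw [(hg _).2, ← ofReal_norm, ← ofReal_norm, norm_inner_symm]

/-- The composition of two Hilbert–Schmidt operators has the composed kernel. -/
theorem kernelOperator_comp_ae {b c : X × X → ℂ} (hb : MemLp b 2 (μ.prod μ))
    (hc : MemLp c 2 (μ.prod μ)) (g : Lp ℂ 2 μ) :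
    ∀ᵐ x ∂μ, Integrable (fun y => (∫ u, b (x, u) * c (u, y) ∂μ) * g y) μ ∧
      (kernelOperator b hb ∘L kernelOperator c hc) g x =
        ∫ y, (∫ u, b (x, u) * c (u, y) ∂μ) * g y ∂μ := by
  -- The operator with kernel `|c|` sends `|g|` into `L²`; pairing the result with the row `b(x, ·)`
  -- gives the absolute integrability that Fubini needs.
  have hn : MemLp (fun p => (‖c p‖ : ℂ)) 2 (μ.prod μ) := hc.norm.ofReal
  have hgn : MemLp (fun y => (‖g y‖ : ℂ)) 2 μ := (Lp.memLp g).norm.ofReal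
  have hM := hn.memLp_integral_mul (hgn.toLp _)
  filter_upwards [kernelOperator_coeFn b hb (kernelOperator c hc g), hb.ae_memLp_prodMk]
    with x hx hbx
  have hF : Integrable (fun p : X × X => b (x, p.1) * c p * g p.2) (μ.prod μ) := by
    have hm : AEStronglyMeasurable (fun p : X × X => b (x, p.1) * c p * g p.2) (μ.prod μ) :=
      (hbx.1.comp_fst.mul hc.1).mul (Lp.aestronglyMeasurable g).comp_snd
    rw [integrable_prod_iff hm]
    constructor
    · filter_upwards [hc.ae_memLp_prodMk] with u hu
      simp_rw [mul_assoc]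
      exact (hu.integrable_mul (Lp.memLp g)).const_mul _
    · have h2 : Integrable (fun u => b (x, u) * ∫ y, (‖c (u, y)‖ : ℂ) * (hgn.toLp _) y ∂μ) μ :=
        hbx.integrable_mul hM
      refine h2.norm.congr (Eventually.of_forall fun u => ?_)
      have h3 : ∫ y, (‖c (u, y)‖ : ℂ) * (hgn.toLp _) y ∂μ
          = ((∫ y, ‖c (u, y)‖ * ‖g y‖ ∂μ : ℝ) : ℂ) := by
        rw [← integral_complex_ofReal]
        refine integral_congr_ae ?_
        filter_upwards [hgn.coeFn_toLp] with y hy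
        rw [hy]; simp
      simp only [norm_mul, h3, mul_assoc]
      rw [integral_const_mul, Complex.norm_real, Real.norm_of_nonneg]
      exact integral_nonneg fun _ => by positivity
  constructor
  · refine hF.integral_prod_right.congr (Eventually.of_forall fun y => ?_)
    simp only
    exact integral_mul_const _ _
  · rw [ContinuousLinearMap.comp_apply, hx]
    have h4 : ∫ u, b (x, u) * (kernelOperator c hc g) u ∂μ
        = ∫ u, ∫ y, b (x, u) * c (u, y) * g y ∂μ ∂μ := by
      refine integral_congr_ae ?_
      filter_upwards [kernelOperator_coeFn c hc g] with u hu
      rw [hu]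
      simp_rw [mul_assoc]
      exact (integral_const_mul _ _).symm
    rw [h4, integral_integral_swap hF]
    exact integral_congr_ae (Eventually.of_forall fun y => integral_mul_const _ _)

end Kernel

/-! ### Contour shift for the Airy integral -/

/-- The integrand of the Airy integral, as an entire function of the integration variable. -/
noncomputable def airyWave (x : ℝ) (w : ℂ) : ℂ :=
  Complex.exp (Complex.I * w ^ 3 / 3) * Complex.exp (Complex.I * w * (x : ℂ))

/-- The real part of `i w³/3` at `w = t + is` is `s³/3 - s t²`. Raising the contour thus gives
Gaussian decay in `t` and the factor `e^{-sx}`. -/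
theorem norm_airyWave (x t s : ℝ) :
    ‖airyWave x (t + s * Complex.I)‖ = Real.exp (s ^ 3 / 3 - s * x) * Real.exp (-s * t ^ 2) := by
  rw [airyWave, norm_mul, Complex.norm_exp, Complex.norm_exp, ← Real.exp_add, ← Real.exp_add]
  congr 1
  have h1 : Complex.I * (t + s * Complex.I) ^ 3 / 3 =
      ((s ^ 3 / 3 - s * t ^ 2 : ℝ) : ℂ) + ((t ^ 3 / 3 - t * s ^ 2 : ℝ) : ℂ) * Complex.I := by
    push_cast
    linear_combination ((t : ℂ) ^ 2 * s  + (t : ℂ) * s ^ 2 * Complex.I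
      + (s : ℂ) ^ 3 / 3 * (Complex.I ^ 2 - 1)) * Complex.I_sq
  have h2 : Complex.I * (t + s * Complex.I) * x =
      ((-s * x : ℝ) : ℂ) + ((t * x : ℝ) : ℂ) * Complex.I := by
    push_cast
    linear_combination ((s : ℂ) * x) * Complex.I_sq
  rw [h1, h2]
  simp only [Complex.add_re, Complex.re_ofReal_mul, Complex.ofReal_re, Complex.I_re]
  ring

theorem differentiable_airyWave (x : ℝ) : Differentiable ℂ (airyWave x) := by
  unfold airyWave
  fun_prop

theorem continuous_airyWave_uncurry (s : ℝ) :
    Continuous fun p : ℝ × ℝ => airyWave p.1 ((p.2 : ℂ) + s * Complex.I) := by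
  unfold airyWave
  fun_prop

theorem integrable_airyWave {s : ℝ} (hs : 0 < s) (x : ℝ) :
    Integrable fun t : ℝ => airyWave x (t + s * Complex.I) := by
  refine ((integrable_exp_neg_mul_sq hs).const_mul (Real.exp (s ^ 3 / 3 - s * x))).mono'
    ((continuous_airyWave_uncurry s).comp (Continuous.prodMk_right x)).aestronglyMeasurable ?_
  exact Eventually.of_forall fun t => (norm_airyWave x t s).le

/-- At each height `y > 0` the integrand decays like `e^{-y a²}`. This is not uniform as `y → 0`, so
dominated convergence is used. The hypothesis on `a²` covers both ends of the line. -/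
theorem tendsto_intervalIntegral_airyWave_vertical {s : ℝ} (hs : 0 < s) (x : ℝ) {l : Filter ℝ}
    [l.IsCountablyGenerated] (hl : Tendsto (fun a : ℝ => a ^ 2) l atTop) :
    Tendsto (fun a : ℝ => ∫ y in (0 : ℝ)..s, airyWave x (a + y * Complex.I)) l (𝓝 0) := by
  have h0 : (0 : ℂ) = ∫ y in (0 : ℝ)..s, (0 : ℂ) := by simp
  rw [h0]
  refine intervalIntegral.tendsto_integral_filter_of_dominated_convergence
    (fun _ => Real.exp (s ^ 3 / 3 + s * |x|)) ?_ ?_ ?_ ?_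
  · refine Eventually.of_forall fun a => Continuous.aestronglyMeasurable ?_
    unfold airyWave
    fun_prop
  · refine Eventually.of_forall fun a => Eventually.of_forall fun y hy => ?_
    rw [Set.uIoc_of_le hs.le] at hy
    rw [norm_airyWave, ← Real.exp_add]
    refine Real.exp_le_exp.2 ?_
    have h1 : y ^ 3 ≤ s ^ 3 := pow_le_pow_left₀ hy.1.le hy.2 3
    have h2 : -(y * x) ≤ s * |x| := by
      calc -(y * x) = y * (-x) := by ring
        _ ≤ y * |x| := mul_le_mul_of_nonneg_left (neg_le_abs x) hy.1.le
        _ ≤ s * |x| := mul_le_mul_of_nonneg_right hy.2 (abs_nonneg x)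
    have h3 : 0 ≤ y * a ^ 2 := mul_nonneg hy.1.le (sq_nonneg a)
    linarith
  · exact intervalIntegrable_const
  · refine Eventually.of_forall fun y hy => ?_
    rw [Set.uIoc_of_le hs.le] at hy
    rw [tendsto_zero_iff_norm_tendsto_zero]
    simp_rw [norm_airyWave]
    rw [← mul_zero (Real.exp (y ^ 3 / 3 - y * x))]
    refine Tendsto.const_mul _ (Real.tendsto_exp_atBot.comp ?_)
    exact hl.const_mul_atTop_of_neg (neg_lt_zero.2 hy.1)

/-- Cauchy's theorem on the rectangle with base `[p.1, p.2]` and height `s`. -/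
theorem airyTruncated_eq_shift (s x : ℝ) (p : ℝ × ℝ) :
    airyTruncated x p = 1 / (2 * (Real.pi : ℂ)) *
      ((∫ t in p.1..p.2, airyWave x (t + s * Complex.I))
        - Complex.I * (∫ y in (0 : ℝ)..s, airyWave x (p.2 + y * Complex.I))
        + Complex.I * (∫ y in (0 : ℝ)..s, airyWave x (p.1 + y * Complex.I))) := by
  have h := Complex.integral_boundary_rect_eq_zero_of_differentiableOn (airyWave x)
    (p.1 : ℂ) (p.2 + s * Complex.I) (differentiable_airyWave x).differentiableOn
  simp only [Complex.ofReal_re, Complex.ofReal_im, Complex.add_re, Complex.add_im, Complex.mul_re,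
    Complex.mul_im, Complex.I_re, Complex.I_im, mul_zero, mul_one, zero_mul, sub_zero, add_zero,
    zero_add, Complex.ofReal_zero, smul_eq_mul] at h
  unfold airyTruncated
  congr 1
  have h2 : (∫ t in p.1..p.2, Complex.exp (Complex.I * (t : ℂ) ^ 3 / 3) *
      Complex.exp (Complex.I * (t : ℂ) * (x : ℂ))) = ∫ t in p.1..p.2, airyWave x t := rfl
  rw [h2]
  linear_combination h

/-- The Airy integral converges to the absolutely convergent integral over any horizontal line in
the upper half plane. -/
theorem tendsto_airyTruncated {s : ℝ} (hs : 0 < s) (x : ℝ) :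
    Tendsto (airyTruncated x) (atBot ×ˢ atTop)
      (𝓝 (1 / (2 * (Real.pi : ℂ)) * ∫ t : ℝ, airyWave x (t + s * Complex.I))) := by
  have h1 := intervalIntegral_tendsto_integral (integrable_airyWave hs x)
    (tendsto_fst (f := (atBot : Filter ℝ)) (g := (atTop : Filter ℝ)))
    (tendsto_snd (f := (atBot : Filter ℝ)) (g := (atTop : Filter ℝ)))
  have h2 := (tendsto_intervalIntegral_airyWave_vertical hs x (l := atTop)
    (tendsto_pow_atTop two_ne_zero)).comp (tendsto_snd (f := (atBot : Filter ℝ)))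
  have h3 := (tendsto_intervalIntegral_airyWave_vertical hs x (l := atBot)
    (by
      simpa [Function.comp_def] using
        (tendsto_pow_atTop (α := ℝ) two_ne_zero).comp tendsto_abs_atBot_atTop)).comp
    (tendsto_fst (g := (atTop : Filter ℝ)))
  have h4 := ((h1.sub (h2.const_mul Complex.I)).add (h3.const_mul Complex.I)).const_mul
    (1 / (2 * (Real.pi : ℂ)))
  rw [mul_zero, sub_zero, add_zero] at h4
  exact h4.congr fun p => (airyTruncated_eq_shift s x p).symm

theorem airyA_eq_integral {s : ℝ} (hs : 0 < s) (x : ℝ) :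
    airyA x = 1 / (2 * (Real.pi : ℂ)) * ∫ t : ℝ, airyWave x (t + s * Complex.I) :=
  (tendsto_airyTruncated hs x).limUnder_eq

/-- The linear factor produced by differentiating in `x` is paid for with half of the Gaussian
`e^{-s t²}`. -/
theorem norm_I_mul_line_le (s t : ℝ) (hs : 0 < s) (hs1 : s ≤ 1) :
    ‖Complex.I * ((t : ℂ) + s * Complex.I)‖ ≤ 2 / s * Real.exp (s / 2 * t ^ 2) := by
  have h1 : ‖Complex.I * ((t : ℂ) + s * Complex.I)‖ ≤ |t| + s := by
    rw [norm_mul, Complex.norm_I, one_mul]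
    refine (norm_add_le _ _).trans ?_
    simp [abs_of_pos hs]
  have h2 := Real.add_one_le_exp (s / 2 * t ^ 2)
  have h3 : (|t| + s) * s ≤ 2 * Real.exp (s / 2 * t ^ 2) := by
    have := sq_abs t
    nlinarith [sq_nonneg (|t| - 1), abs_nonneg t]
  rw [div_mul_eq_mul_div, le_div_iff₀ hs]
  exact (mul_le_mul_of_nonneg_right h1 hs.le).trans h3

theorem hasDerivAt_airyWave (x : ℝ) (w : ℂ) :
    HasDerivAt (fun x : ℝ => airyWave x w) (Complex.I * w * airyWave x w) x := by
  have h1 : HasDerivAt (fun x : ℝ => Complex.I * w * (x : ℂ)) (Complex.I * w) x := by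
    simpa using (Complex.ofRealCLM.hasDerivAt (x := x)).const_mul (Complex.I * w)
  have h2 := (h1.cexp).const_mul (Complex.exp (Complex.I * w ^ 3 / 3))
  refine h2.congr_deriv ?_
  simp only [airyWave]
  ring

theorem norm_I_mul_airyWave_le {s : ℝ} (hs : 0 < s) (hs1 : s ≤ 1) (x t : ℝ) :
    ‖Complex.I * (t + s * Complex.I) * airyWave x (t + s * Complex.I)‖ ≤
      2 / s * Real.exp (s ^ 3 / 3 - s * x) * Real.exp (-(s / 2) * t ^ 2) := by
  rw [norm_mul, norm_airyWave]
  calc _ ≤ (2 / s * Real.exp (s / 2 * t ^ 2)) *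
        (Real.exp (s ^ 3 / 3 - s * x) * Real.exp (-s * t ^ 2)) := by
        gcongr
        exact norm_I_mul_line_le s t hs hs1
    _ = 2 / s * Real.exp (s ^ 3 / 3 - s * x) *
        (Real.exp (s / 2 * t ^ 2) * Real.exp (-s * t ^ 2)) := by ring
    _ = _ := by rw [← Real.exp_add]; ring_nf

theorem hasDerivAt_airyA {s : ℝ} (hs : 0 < s) (hs1 : s ≤ 1) (x : ℝ) :
    HasDerivAt airyA (1 / (2 * (Real.pi : ℂ)) *
      ∫ t : ℝ, Complex.I * (t + s * Complex.I) * airyWave x (t + s * Complex.I)) x := by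
  rw [show airyA = _ from funext fun x => airyA_eq_integral hs x]
  refine HasDerivAt.const_mul _ ?_
  refine (hasDerivAt_integral_of_dominated_loc_of_deriv_le
    (F := fun (y : ℝ) (t : ℝ) => airyWave y (t + s * Complex.I))
    (F' := fun (y : ℝ) (t : ℝ) =>
      Complex.I * (t + s * Complex.I) * airyWave y (t + s * Complex.I))
    (s := Metric.ball x 1)
    (bound := fun t => 2 / s * Real.exp (s ^ 3 / 3 + s * (|x| + 1)) * Real.exp (-(s / 2) * t ^ 2))
    (Metric.ball_mem_nhds x one_pos) ?_ (integrable_airyWave hs x) ?_ ?_ ?_ ?_).2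
  · exact Eventually.of_forall fun y => (integrable_airyWave hs y).1
  · refine Continuous.aestronglyMeasurable ?_
    unfold airyWave
    fun_prop
  · refine Eventually.of_forall fun t y hy => (norm_I_mul_airyWave_le hs hs1 y t).trans ?_
    gcongr
    rw [sub_eq_add_neg, ← mul_neg]
    gcongr
    rw [Metric.mem_ball, Real.dist_eq] at hy
    have h1 := abs_sub_abs_le_abs_sub y x
    have h2 := neg_le_abs y
    linarith
  · exact (integrable_exp_neg_mul_sq (by positivity)).const_mul _
  · exact Eventually.of_forall fun t y _ => hasDerivAt_airyWave y _

theorem differentiable_airyA : Differentiable ℝ airyA := fun x =>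
  (hasDerivAt_airyA one_pos le_rfl x).differentiableAt

/-! ### Pointwise bounds for the Airy function and its derivative -/

theorem exp_line_le (u z : ℝ) :
    Real.exp ((1 / (1 + |u|)) ^ 3 / 3 - 1 / (1 + |u|) * (u + z)) ≤
      Real.exp 2 * Real.exp (-z / (1 + |u|)) := by
  rw [← Real.exp_add]
  refine Real.exp_le_exp.2 ?_
  have hN : (0 : ℝ) < 1 + |u| := by positivity
  have hs : (0 : ℝ) ≤ 1 / (1 + |u|) := by positivity
  have hs1 : 1 / (1 + |u|) ≤ 1 := by rw [div_le_one hN]; linarith [abs_nonneg u]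
  have h1 : (1 / (1 + |u|)) ^ 3 ≤ 1 := pow_le_one₀ hs hs1
  have h2 : -(1 / (1 + |u|) * u) ≤ 1 := by
    rw [← mul_neg, one_div_mul_eq_div, div_le_one hN]
    linarith [neg_le_abs u]
  have h3 : 1 / (1 + |u|) * (u + z) = 1 / (1 + |u|) * u + z / (1 + |u|) := by ring
  rw [h3, neg_div]
  linarith

theorem norm_inv_two_pi_mul (v : ℂ) :
    ‖1 / (2 * (Real.pi : ℂ)) * v‖ = 1 / (2 * Real.pi) * ‖v‖ := by
  simp [abs_of_pos Real.pi_pos]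

theorem sqrt_le_two_pi_mul {r N : ℝ} (hN : 1 ≤ N) (h : r ≤ 2 * Real.pi * N) :
    √r ≤ 2 * Real.pi * N := by
  rw [Real.sqrt_le_left (by positivity)]
  have : 1 ≤ 2 * Real.pi * N := by nlinarith [Real.pi_gt_three]
  nlinarith

/-- The contour height `s = 1/(1+|u|)` keeps `e^{-su}` bounded and leaves the decay `e^{-sz}`; the
Gaussian integral costs `√(π/s)`. The constant and the square are larger than needed, to share one
form with the bound for the derivative. -/
theorem norm_airyA_add_le (u z : ℝ) :
    ‖airyA (u + z)‖ ≤ 2 * Real.exp 2 * (1 + |u|) ^ 2 * Real.exp (-z / (1 + |u|)) := by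
  have hN : (1 : ℝ) ≤ 1 + |u| := by linarith [abs_nonneg u]
  have hs : (0 : ℝ) < 1 / (1 + |u|) := by positivity
  rw [airyA_eq_integral hs, norm_inv_two_pi_mul]
  have h1 : ‖∫ t : ℝ, airyWave (u + z) (t + (1 / (1 + |u|) : ℝ) * Complex.I)‖ ≤
      (Real.exp 2 * Real.exp (-z / (1 + |u|))) * (2 * Real.pi * (1 + |u|)) := by
    refine (norm_integral_le_integral_norm _).trans ?_
    simp_rw [norm_airyWave]
    rw [integral_const_mul, integral_gaussian]
    gcongr
    · exact exp_line_le u z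
    · refine sqrt_le_two_pi_mul hN ?_
      rw [div_div_eq_mul_div, div_one]
      gcongr
      linarith [Real.pi_pos]
  calc _ ≤ 1 / (2 * Real.pi) *
        ((Real.exp 2 * Real.exp (-z / (1 + |u|))) * (2 * Real.pi * (1 + |u|))) := by gcongr
    _ = 1 * Real.exp 2 * (1 + |u|) * Real.exp (-z / (1 + |u|)) := by
      have := Real.pi_pos
      field_simp
    _ ≤ _ := by
      gcongr
      · norm_num
      · nlinarith

theorem norm_deriv_airyA_add_le (u z : ℝ) :
    ‖deriv airyA (u + z)‖ ≤ 2 * Real.exp 2 * (1 + |u|) ^ 2 * Real.exp (-z / (1 + |u|)) := by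
  have hN : (1 : ℝ) ≤ 1 + |u| := by linarith [abs_nonneg u]
  have hs : (0 : ℝ) < 1 / (1 + |u|) := by positivity
  have hs1 : 1 / (1 + |u|) ≤ 1 := by rw [div_le_one (by positivity)]; exact hN
  rw [(hasDerivAt_airyA hs hs1 _).deriv, norm_inv_two_pi_mul]
  have h1 : ‖∫ t : ℝ, Complex.I * (t + (1 / (1 + |u|) : ℝ) * Complex.I) *
      airyWave (u + z) (t + (1 / (1 + |u|) : ℝ) * Complex.I)‖ ≤
      (2 * (1 + |u|) * (Real.exp 2 * Real.exp (-z / (1 + |u|)))) * (2 * Real.pi * (1 + |u|)) := by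
    refine (norm_integral_le_of_norm_le
      ((integrable_exp_neg_mul_sq (b := 1 / (1 + |u|) / 2) (by positivity)).const_mul _)
      (Eventually.of_forall fun t => norm_I_mul_airyWave_le hs hs1 (u + z) t)).trans ?_
    rw [integral_const_mul, integral_gaussian]
    gcongr
    · rw [div_div_eq_mul_div, div_one]
    · exact exp_line_le u z
    · refine sqrt_le_two_pi_mul hN (le_of_eq ?_)
      field_simp
  calc _ ≤ 1 / (2 * Real.pi) * ((2 * (1 + |u|) * (Real.exp 2 * Real.exp (-z / (1 + |u|)))) *
        (2 * Real.pi * (1 + |u|))) := by gcongr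
    _ = _ := by
      have := Real.pi_pos
      field_simp

/-! ### Plancherel for integrable, square integrable functions -/

theorem Real.continuous_fourier_of_integrable {k : ℝ → ℂ} (h1 : Integrable k) :
    Continuous (𝓕 k) :=
  VectorFourier.fourierIntegral_continuous Real.continuous_fourierChar
    (by exact continuous_inner) h1

/-- The `L²` Fourier transform of an integrable function is given by the Fourier integral. -/
theorem MeasureTheory.MemLp.fourier_toLp_ae_eq {k : ℝ → ℂ} (h1 : Integrable k) (h2 : MemLp k 2) :
    (𝓕 (h2.toLp k) : Lp ℂ 2 (volume : Measure ℝ)) =ᵐ[volume] 𝓕 k := by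
  refine ae_eq_of_integral_contDiff_smul_eq ((Lp.memLp _).locallyIntegrable one_le_two)
    (Real.continuous_fourier_of_integrable h1).locallyIntegrable fun g g_smooth g_cpt => ?_
  have hg₁ : HasCompactSupport (Complex.ofRealCLM ∘ g) := g_cpt.comp_left rfl
  have hg₂ : ContDiff ℝ (↑(⊤ : ℕ∞)) (Complex.ofRealCLM ∘ g) := by fun_prop
  -- Against a test function, the distributional definition moves the `L²` transform onto `φ`; the
  -- `L¹` exchange formula moves it back onto `k`.
  set φ : 𝓢(ℝ, ℂ) := hg₁.toSchwartzMap hg₂ with hφ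
  have hφg : ∀ x, φ x = (g x : ℂ) := fun x => rfl
  have h3 := congrArg (fun T : 𝓢'(ℝ, ℂ) => T φ)
    (Lp.fourier_toTemperedDistribution_eq (h2.toLp k))
  simp only [TemperedDistribution.fourier_apply] at h3
  rw [Lp.toTemperedDistribution_apply, Lp.toTemperedDistribution_apply] at h3
  have h4 : ∫ x, (𝓕 φ) x • (h2.toLp k) x = ∫ x, (𝓕 φ) x • k x :=
    integral_congr_ae (h2.coeFn_toLp.mono fun x hx => by simp only [hx])
  have h5 : ∫ x, (𝓕 φ) x • k x = ∫ x, φ x • 𝓕 k x := by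
    rw [SchwartzMap.fourier_coe]
    have := VectorFourier.integral_fourierIntegral_smul_eq_flip (L := innerₗ ℝ)
      Real.continuous_fourierChar (by exact continuous_inner)
      (φ.integrable (μ := (volume : Measure ℝ))) h1
    rwa [flip_innerₗ] at this
  have h6 := h3.symm.trans (h4.trans h5)
  simpa [hφg] using h6

/-- Plancherel's theorem for functions in `L¹ ∩ L²`. -/
theorem Real.eLpNorm_fourier_eq {k : ℝ → ℂ} (h1 : Integrable k) (h2 : MemLp k 2) :
    eLpNorm (𝓕 k) 2 = eLpNorm k 2 := by
  rw [← eLpNorm_congr_ae (MemLp.fourier_toLp_ae_eq h1 h2), ← Lp.enorm_def, ← ofReal_norm,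
    Lp.norm_fourier_eq, ofReal_norm, Lp.enorm_def, eLpNorm_congr_ae h2.coeFn_toLp]

theorem Real.eLpNorm_fourierInv_eq {k : ℝ → ℂ} (h1 : Integrable k) (h2 : MemLp k 2) :
    eLpNorm (𝓕⁻ k) 2 = eLpNorm k 2 := by
  rw [← Real.eLpNorm_fourier_eq h1 h2]
  have h3 : 𝓕⁻ k = 𝓕 k ∘ Neg.neg := funext fun x => Real.fourierInv_eq_fourier_neg k x
  rw [h3, eLpNorm_comp_measurePreserving
    (Real.continuous_fourier_of_integrable h1).aestronglyMeasurable
    (Measure.measurePreserving_neg volume)]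

theorem Real.continuous_fourierInv_of_integrable {k : ℝ → ℂ} (h1 : Integrable k) :
    Continuous (𝓕⁻ k) := by
  have h3 : 𝓕⁻ k = 𝓕 k ∘ Neg.neg := funext fun x => Real.fourierInv_eq_fourier_neg k x
  rw [h3]
  exact (Real.continuous_fourier_of_integrable h1).comp continuous_neg

/-! ### The Airy transform as a Fourier multiplier -/

/-- The multiplier whose inverse Fourier transform is `x ↦ e^{s x} A(x)`. -/
noncomputable def airyMultiplier (s τ : ℝ) : ℂ :=
  Complex.exp (Complex.I * ((2 * Real.pi * τ : ℝ) + s * Complex.I) ^ 3 / 3)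

theorem norm_airyMultiplier (s τ : ℝ) : ‖airyMultiplier s τ‖ =
    Real.exp (s ^ 3 / 3) * Real.exp (-s * (2 * Real.pi * τ) ^ 2) := by
  have := norm_airyWave 0 (2 * Real.pi * τ) s
  simpa [airyWave, airyMultiplier] using this

theorem norm_airyMultiplier_le {s : ℝ} (hs : 0 < s) (τ : ℝ) :
    ‖airyMultiplier s τ‖ ≤ Real.exp (s ^ 3 / 3) := by
  rw [norm_airyMultiplier]
  refine mul_le_of_le_one_right (Real.exp_nonneg _) (Real.exp_le_one_iff.2 ?_)
  nlinarith [sq_nonneg (2 * Real.pi * τ)]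

theorem continuous_airyMultiplier (s : ℝ) : Continuous (airyMultiplier s) := by
  unfold airyMultiplier
  fun_prop

theorem integrable_airyMultiplier {s : ℝ} (hs : 0 < s) : Integrable (airyMultiplier s) := by
  have h : Integrable fun τ : ℝ => airyWave 0 ((2 * Real.pi * τ : ℝ) + s * Complex.I) :=
    (integrable_airyWave hs 0).comp_mul_left' (by positivity)
  refine h.congr (Eventually.of_forall fun τ => ?_)
  simp [airyWave, airyMultiplier]

theorem airyA_eq_multiplier {s : ℝ} (hs : 0 < s) (x : ℝ) :
    airyA x = Real.exp (-s * x) *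
      ∫ τ : ℝ, airyMultiplier s τ * Complex.exp ((2 * Real.pi * (τ * x) : ℝ) * Complex.I) := by
  have h := Measure.integral_comp_mul_left
    (fun t : ℝ => airyWave x (t + s * Complex.I)) (2 * Real.pi)
  rw [airyA_eq_integral hs x]
  have h2 : (1 / (2 * (Real.pi : ℂ)) * ∫ t : ℝ, airyWave x (t + s * Complex.I)) =
      |(2 * Real.pi)⁻¹| • ∫ t : ℝ, airyWave x (t + s * Complex.I) := by
    rw [abs_of_pos (by positivity), Complex.real_smul]
    simp
  rw [h2, ← h, ← integral_const_mul]
  refine integral_congr_ae (Eventually.of_forall fun τ => ?_)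
  simp only [airyWave, airyMultiplier]
  rw [mul_left_comm, Complex.ofReal_exp, ← Complex.exp_add ((-s * x : ℝ) : ℂ)]
  congr 1
  congr 1
  push_cast
  linear_combination ((s : ℂ) * x) * Complex.I_sq

theorem integrableOn_mul_airyA {h : ℝ → ℂ} (hm : Measurable h) {M c : ℝ} (hc : 0 < c)
    (hb : ∀ z, 0 < z → ‖h z‖ ≤ M * Real.exp (-c * z)) (y : ℝ) :
    IntegrableOn (fun z => h z * airyA (z + y)) (Set.Ioi 0) := by
  refine Integrable.mono' ((exp_neg_integrableOn_Ioi 0 hc).const_mul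
    (M * (2 * Real.exp 2 * (1 + |y|) ^ 2)))
    (hm.mul (differentiable_airyA.continuous.measurable.comp
      (measurable_id.add_const y))).aestronglyMeasurable ?_
  refine (ae_restrict_iff' measurableSet_Ioi).2 (Eventually.of_forall fun z (hz : 0 < z) => ?_)
  have h1 : ‖airyA (z + y)‖ ≤ 2 * Real.exp 2 * (1 + |y|) ^ 2 := by
    rw [add_comm]
    refine (norm_airyA_add_le y z).trans (mul_le_of_le_one_right (by positivity) ?_)
    rw [Real.exp_le_one_iff]
    exact div_nonpos_of_nonpos_of_nonneg (by linarith) (by positivity)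
  rw [norm_mul]
  calc _ ≤ (M * Real.exp (-c * z)) * (2 * Real.exp 2 * (1 + |y|) ^ 2) := by
        gcongr
        · exact (norm_nonneg _).trans (hb z hz)
        · exact hb z hz
    _ = _ := by ring

theorem eLpNorm_indicator_mul_exp_le (h : ℝ → ℂ) {s : ℝ} (hs : 0 < s) :
    eLpNorm ((Set.Ioi 0).indicator fun z => h z * Real.exp (-s * z)) 2 ≤
      eLpNorm h 2 (volume.restrict (Set.Ioi 0)) := by
  rw [eLpNorm_indicator_eq_eLpNorm_restrict measurableSet_Ioi]
  refine eLpNorm_mono_ae ((ae_restrict_iff' measurableSet_Ioi).2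
    (Eventually.of_forall fun z (hz : 0 < z) => ?_))
  rw [norm_mul, Complex.norm_real, Real.norm_of_nonneg (Real.exp_nonneg _)]
  refine mul_le_of_le_one_right (norm_nonneg _) ?_
  rw [Real.exp_le_one_iff]
  nlinarith

section AiryTransform

variable {h : ℝ → ℂ} (hm : Measurable h) {M c : ℝ} (hc : 0 < c)
  (hb : ∀ z, 0 < z → ‖h z‖ ≤ M * Real.exp (-c * z))

include hm hc hb

theorem integrable_indicator_mul_exp {s : ℝ} (hs : 0 < s) :
    Integrable ((Set.Ioi 0).indicator fun z => h z * Real.exp (-s * z)) := by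
  rw [integrable_indicator_iff measurableSet_Ioi]
  refine Integrable.mono' ((exp_neg_integrableOn_Ioi 0 hc).const_mul M)
    (by fun_prop) ?_
  refine (ae_restrict_iff' measurableSet_Ioi).2 (Eventually.of_forall fun z (hz : 0 < z) => ?_)
  rw [norm_mul, Complex.norm_real, Real.norm_of_nonneg (Real.exp_nonneg _)]
  refine (mul_le_of_le_one_right (norm_nonneg _) ?_).trans (hb z hz)
  rw [Real.exp_le_one_iff]
  nlinarith

theorem memLp_of_exp_decay : MemLp h 2 (volume.restrict (Set.Ioi 0)) := by
  refine (memLp_two_iff_integrable_sq_norm hm.aestronglyMeasurable).2 ?_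
  refine Integrable.mono' ((exp_neg_integrableOn_Ioi 0 (b := 2 * c) (by positivity)).const_mul
    (M ^ 2)) (by fun_prop) ?_
  refine (ae_restrict_iff' measurableSet_Ioi).2 (Eventually.of_forall fun z (hz : 0 < z) => ?_)
  rw [Real.norm_of_nonneg (by positivity)]
  calc ‖h z‖ ^ 2 ≤ (M * Real.exp (-c * z)) ^ 2 := by
        gcongr
        exact hb z hz
    _ = _ := by
      rw [mul_pow, ← Real.exp_nat_mul]
      congr 2
      push_cast
      ring

/-- The weight `e^{sy}` turns the factor `e^{-s(z+y)}` of `A(z+y)` into the damping `e^{-sz}`. The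
kernel depends on `z + y` rather than on a difference, so both transforms are inverse ones. -/
theorem airyTransform_eq_fourierInv {s : ℝ} (hs : 0 < s) (y : ℝ) :
    Real.exp (s * y) * ∫ z in Set.Ioi (0 : ℝ), h z * airyA (z + y) =
      𝓕⁻ (fun τ => airyMultiplier s τ *
        𝓕⁻ ((Set.Ioi 0).indicator fun z => h z * Real.exp (-s * z)) τ) y := by
  set k : ℝ → ℂ := (Set.Ioi 0).indicator fun z => h z * Real.exp (-s * z) with hk
  have hki : Integrable k := integrable_indicator_mul_exp hm hc hb hs
  have h1 : Real.exp (s * y) * ∫ z in Set.Ioi (0 : ℝ), h z * airyA (z + y) =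
      ∫ z, ∫ τ, k z * (airyMultiplier s τ *
        Complex.exp ((2 * Real.pi * (τ * (z + y)) : ℝ) * Complex.I)) := by
    rw [← integral_indicator measurableSet_Ioi, ← integral_const_mul]
    refine integral_congr_ae (Eventually.of_forall fun z => ?_)
    simp only
    rw [integral_const_mul, hk]
    by_cases hz : z ∈ Set.Ioi (0 : ℝ)
    · rw [Set.indicator_of_mem hz, Set.indicator_of_mem hz, airyA_eq_multiplier hs]
      have : (Real.exp (-s * (z + y)) : ℂ) = Real.exp (-s * z) * (Real.exp (s * y) : ℂ)⁻¹ := by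
        rw [← Complex.ofReal_inv, ← Real.exp_neg, ← Complex.ofReal_mul, ← Real.exp_add]
        ring_nf
      rw [this]
      have h0 : (Real.exp (s * y) : ℂ) ≠ 0 := by simp
      linear_combination (h z * Real.exp (-s * z) * ∫ τ : ℝ, airyMultiplier s τ *
        Complex.exp ((2 * Real.pi * (τ * (z + y)) : ℝ) * Complex.I)) * mul_inv_cancel₀ h0
    · rw [Set.indicator_of_notMem hz, Set.indicator_of_notMem hz]
      simp
  have hint : Integrable (Function.uncurry fun z τ : ℝ => k z * (airyMultiplier s τ *
        Complex.exp ((2 * Real.pi * (τ * (z + y)) : ℝ) * Complex.I))) (volume.prod volume) := by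
    have h2 := hki.mul_prod (integrable_airyMultiplier hs)
    refine h2.mono (h2.1.mul (g := fun p : ℝ × ℝ =>
      Complex.exp ((2 * Real.pi * (p.2 * (p.1 + y)) : ℝ) * Complex.I))
      (by fun_prop) |>.congr (Eventually.of_forall fun p => ?_)) (Eventually.of_forall fun p => ?_)
    · simp only [Function.uncurry, Pi.mul_apply, mul_assoc]
    · simp only [Function.uncurry, norm_mul, Complex.norm_exp_ofReal_mul_I, mul_one, le_refl]
  rw [h1, integral_integral_swap hint, Real.fourierInv_eq']
  refine integral_congr_ae (Eventually.of_forall fun τ => ?_)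
  simp only
  rw [Real.fourierInv_eq', smul_eq_mul, ← integral_const_mul, ← integral_const_mul]
  refine integral_congr_ae (Eventually.of_forall fun z => ?_)
  have h3 : (inner ℝ τ y : ℝ) = τ * y := by simp [mul_comm]
  have h4 : (inner ℝ z τ : ℝ) = τ * z := by simp
  simp only [h3, h4, smul_eq_mul]
  have h5 : Complex.exp ((2 * Real.pi * (τ * (z + y)) : ℝ) * Complex.I) =
      Complex.exp ((2 * Real.pi * (τ * y) : ℝ) * Complex.I) *
        Complex.exp ((2 * Real.pi * (τ * z) : ℝ) * Complex.I) := by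
    rw [← Complex.exp_add]
    congr 1
    push_cast
    ring
  rw [h5]
  ring

/-- Plancherel twice: the multiplier is at most `e^{s³/3}`, and the damping `e^{-sz}` only lowers
the norm on `(0, ∞)`. -/
theorem airyTransform_weighted {s : ℝ} (hs : 0 < s) :
    (Continuous fun y : ℝ =>
      (Real.exp (s * y) : ℂ) * ∫ z in Set.Ioi (0 : ℝ), h z * airyA (z + y)) ∧
    eLpNorm (fun y : ℝ => (Real.exp (s * y) : ℂ) * ∫ z in Set.Ioi (0 : ℝ), h z * airyA (z + y)) 2 ≤
      ENNReal.ofReal (Real.exp (s ^ 3 / 3)) * eLpNorm h 2 (volume.restrict (Set.Ioi 0)) := by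
  set k : ℝ → ℂ := (Set.Ioi 0).indicator fun z => h z * Real.exp (-s * z) with hk
  have hki : Integrable k := integrable_indicator_mul_exp hm hc hb hs
  have hk2 : MemLp k 2 :=
    ⟨hki.1, (eLpNorm_indicator_mul_exp_le h hs).trans_lt (memLp_of_exp_decay hm hc hb).2⟩
  have hkc := Real.continuous_fourierInv_of_integrable hki
  have hb' : ∀ τ, ‖airyMultiplier s τ * 𝓕⁻ k τ‖ ≤ Real.exp (s ^ 3 / 3) * ‖𝓕⁻ k τ‖ := fun τ => by
    rw [norm_mul]
    gcongr
    exact norm_airyMultiplier_le hs τ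
  have hFk : eLpNorm (fun τ => airyMultiplier s τ * 𝓕⁻ k τ) 2 ≤
      ENNReal.ofReal (Real.exp (s ^ 3 / 3)) * eLpNorm k 2 := by
    rw [← Real.eLpNorm_fourierInv_eq hki hk2]
    exact eLpNorm_le_mul_eLpNorm_of_ae_le_mul (Eventually.of_forall hb') 2
  have hp2 : MemLp (fun τ => airyMultiplier s τ * 𝓕⁻ k τ) 2 :=
    ⟨((continuous_airyMultiplier s).mul hkc).aestronglyMeasurable,
      hFk.trans_lt (ENNReal.mul_lt_top (by simp) hk2.2)⟩
  have hp1 : Integrable (fun τ => airyMultiplier s τ * 𝓕⁻ k τ) := by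
    refine (integrable_airyMultiplier hs).mul_bdd (c := ∫ z, ‖k z‖) hkc.aestronglyMeasurable
      (Eventually.of_forall fun τ => ?_)
    rw [Real.fourierInv_eq']
    refine (norm_integral_le_integral_norm _).trans (le_of_eq ?_)
    simp only [norm_smul, Complex.norm_exp_ofReal_mul_I, one_mul]
  have heq := funext (airyTransform_eq_fourierInv hm hc hb hs)
  rw [heq]
  refine ⟨Real.continuous_fourierInv_of_integrable hp1, ?_⟩
  rw [Real.eLpNorm_fourierInv_eq hp1 hp2]
  refine hFk.trans ?_
  gcongr
  exact eLpNorm_indicator_mul_exp_le h hs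

/-- The Airy transform is a contraction from `L²(0, ∞)` to `L²(ℝ)`. -/
theorem eLpNorm_airyTransform_le :
    eLpNorm (fun y : ℝ => ∫ z in Set.Ioi (0 : ℝ), h z * airyA (z + y)) 2 ≤
      eLpNorm h 2 (volume.restrict (Set.Ioi 0)) := by
  -- At `s = 0` the multiplier is unimodular but not integrable, so the bound is reached by Fatou
  -- along `s = 1/(n+1) → 0`, where `e^{s³/3} → 1`.
  have hs : ∀ n : ℕ, (0 : ℝ) < 1 / ((n : ℝ) + 1) := fun n => by positivity
  have hs0 : Tendsto (fun n : ℕ => 1 / ((n : ℝ) + 1)) atTop (𝓝 0) :=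
    tendsto_one_div_add_atTop_nhds_zero_nat
  have h1 : eLpNorm (fun y : ℝ => ∫ z in Set.Ioi (0 : ℝ), h z * airyA (z + y)) 2 ≤ _ :=
    Lp.eLpNorm_lim_le_liminf_eLpNorm (p := 2)
      (fun n => (airyTransform_weighted hm hc hb (hs n)).1.aestronglyMeasurable)
      (fun y : ℝ => ∫ z in Set.Ioi (0 : ℝ), h z * airyA (z + y)) (Eventually.of_forall fun y => by
        have h2 : Tendsto (fun n : ℕ => (Real.exp (1 / ((n : ℝ) + 1) * y) : ℂ)) atTop (𝓝 1) := by
          have h3 : Continuous fun s : ℝ => (Real.exp (s * y) : ℂ) := by fun_prop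
          simpa only [Function.comp_def, zero_mul, ne_eq, OfNat.ofNat_ne_zero, not_false_eq_true,
            zero_pow, zero_div, Real.exp_zero, Complex.ofReal_one, ENNReal.ofReal_one] using
            (h3.tendsto 0).comp hs0
        simpa using h2.mul_const (∫ z in Set.Ioi (0 : ℝ), h z * airyA (z + y)))
  refine h1.trans ?_
  refine (liminf_le_liminf (Eventually.of_forall fun n =>
    (airyTransform_weighted hm hc hb (hs n)).2)).trans (le_of_eq (Tendsto.liminf_eq ?_))
  have h2 : Tendsto (fun n : ℕ => ENNReal.ofReal (Real.exp ((1 / ((n : ℝ) + 1)) ^ 3 / 3))) atTop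
      (𝓝 1) := by
    have h3 : Continuous fun s : ℝ => ENNReal.ofReal (Real.exp (s ^ 3 / 3)) :=
      ENNReal.continuous_ofReal.comp (by fun_prop)
    simpa only [Function.comp_def, zero_mul, ne_eq, OfNat.ofNat_ne_zero, not_false_eq_true,
            zero_pow, zero_div, Real.exp_zero, Complex.ofReal_one, ENNReal.ofReal_one] using
            (h3.tendsto 0).comp hs0
  simpa using ENNReal.Tendsto.mul_const h2 (Or.inl one_ne_zero)

end AiryTransform

/-! ### Bounds and differentiation for the Airy pairing -/

/-- Measurability together with the decay estimate shared by the Airy function and its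
derivative. -/
def HasAiryBound (a : ℝ → ℂ) : Prop :=
  Measurable a ∧ ∀ u z : ℝ, ‖a (u + z)‖ ≤
    2 * Real.exp 2 * (1 + |u|) ^ 2 * Real.exp (-(1 + |u|)⁻¹ * z)

theorem hasAiryBound_airyA : HasAiryBound airyA :=
  ⟨differentiable_airyA.continuous.measurable, fun u z => (norm_airyA_add_le u z).trans_eq
    (by rw [neg_div, div_eq_inv_mul, neg_mul])⟩

theorem hasAiryBound_deriv_airyA : HasAiryBound (deriv airyA) :=
  ⟨measurable_deriv _, fun u z => (norm_deriv_airyA_add_le u z).trans_eq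
    (by rw [neg_div, div_eq_inv_mul, neg_mul])⟩

/-- The integral `∫_0^∞ a(u + z) A(z + y) dz`. -/
noncomputable def airyPairing (a : ℝ → ℂ) (u y : ℝ) : ℂ :=
  ∫ z in Set.Ioi (0 : ℝ), a (u + z) * airyA (z + y)

namespace HasAiryBound

variable {a : ℝ → ℂ} (ha : HasAiryBound a)

include ha

theorem norm_add_le (u : ℝ) {z : ℝ} (hz : 0 ≤ z) :
    ‖a (u + z)‖ ≤ 2 * Real.exp 2 * (1 + |u|) ^ 2 := by
  refine (ha.2 u z).trans (mul_le_of_le_one_right (by positivity) ?_)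
  rw [Real.exp_le_one_iff, neg_mul, neg_nonpos]
  positivity

theorem measurable_add (u : ℝ) : Measurable fun z => a (u + z) :=
  ha.1.comp (measurable_const_add u)

theorem integrableOn (u y : ℝ) :
    IntegrableOn (fun z => a (u + z) * airyA (z + y)) (Set.Ioi 0) :=
  integrableOn_mul_airyA (ha.measurable_add u) (c := (1 + |u|)⁻¹) (by positivity)
    (fun z _ => ha.2 u z) y

/-- Four powers of `1 + |u|` come from squaring the bound, the fifth from integrating
`e^{-2z/(1+|u|)}`. -/
theorem lintegral_enorm_sq_le (u : ℝ) :
    ∫⁻ z in Set.Ioi (0 : ℝ), ‖a (u + z)‖ₑ ^ 2 ≤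
      ENNReal.ofReal ((2 * Real.exp 2) ^ 2 * (1 + |u|) ^ 5) := by
  have hN : 0 < 1 + |u| := by positivity
  have hneg : -2 * (1 + |u|)⁻¹ < 0 := by
    have : 0 < (1 + |u|)⁻¹ := by positivity
    linarith
  have hint := (integrableOn_exp_mul_Ioi hneg 0).const_mul ((2 * Real.exp 2 * (1 + |u|) ^ 2) ^ 2)
  calc ∫⁻ z in Set.Ioi (0 : ℝ), ‖a (u + z)‖ₑ ^ 2
      ≤ ∫⁻ z in Set.Ioi (0 : ℝ), ENNReal.ofReal ((2 * Real.exp 2 * (1 + |u|) ^ 2) ^ 2 *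
          Real.exp (-2 * (1 + |u|)⁻¹ * z)) := by
        refine lintegral_mono fun z => ?_
        rw [← ofReal_norm, ← ENNReal.ofReal_pow (norm_nonneg _)]
        refine ENNReal.ofReal_le_ofReal ?_
        refine (pow_le_pow_left₀ (norm_nonneg _) (ha.2 u z) 2).trans_eq ?_
        rw [mul_pow, ← Real.exp_nat_mul]
        congr 2
        push_cast
        ring
    _ = ENNReal.ofReal (∫ z in Set.Ioi (0 : ℝ), (2 * Real.exp 2 * (1 + |u|) ^ 2) ^ 2 *
          Real.exp (-2 * (1 + |u|)⁻¹ * z)) :=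
        (ofReal_integral_eq_lintegral_ofReal hint
          (Eventually.of_forall fun z => by positivity)).symm
    _ ≤ _ := by
        refine ENNReal.ofReal_le_ofReal ?_
        rw [integral_const_mul, integral_exp_mul_Ioi hneg, mul_zero, Real.exp_zero]
        have h1 : (2 * Real.exp 2 * (1 + |u|) ^ 2) ^ 2 * (-1 / (-2 * (1 + |u|)⁻¹)) =
            (2 * Real.exp 2) ^ 2 * (1 + |u|) ^ 5 / 2 := by
          field_simp
        rw [h1]
        exact half_le_self (by positivity)

theorem lintegral_enorm_airyPairing_sq_le (u : ℝ) :
    ∫⁻ y, ‖airyPairing a u y‖ₑ ^ 2 ≤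
      ENNReal.ofReal ((2 * Real.exp 2) ^ 2 * (1 + |u|) ^ 5) := by
  have h1 := eLpNorm_airyTransform_le (ha.measurable_add u) (c := (1 + |u|)⁻¹) (by positivity)
    (fun z _ => ha.2 u z)
  have h2 := pow_le_pow_left₀ zero_le h1 2
  have h3 : ∀ (f : ℝ → ℂ) (μ : Measure ℝ), eLpNorm f 2 μ ^ 2 = ∫⁻ x, ‖f x‖ₑ ^ 2 ∂μ := by
    intro f μ
    rw [eLpNorm_eq_lintegral_rpow_enorm_toReal (by simp) (by simp), ← ENNReal.rpow_natCast,
      ← ENNReal.rpow_mul]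
    simp
  rw [h3, h3] at h2
  exact h2.trans (ha.lintegral_enorm_sq_le u)

/-- Here the decay in `z` is taken from `A(z+y)`. The bound grows in `y`, so it gives no `L²`
control there; it serves integrability and limits in `u` at fixed `y`. -/
theorem norm_airyPairing_le (u y : ℝ) :
    ‖airyPairing a u y‖ ≤ (2 * Real.exp 2) ^ 2 * (1 + |y|) ^ 3 * (1 + |u|) ^ 2 := by
  have hneg : -(1 + |y|)⁻¹ < 0 := neg_lt_zero.2 (by positivity)
  have hint := (integrableOn_exp_mul_Ioi hneg 0).const_mul
    ((2 * Real.exp 2) ^ 2 * (1 + |y|) ^ 2 * (1 + |u|) ^ 2)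
  refine (norm_integral_le_of_norm_le hint ((ae_restrict_iff' measurableSet_Ioi).2
    (Eventually.of_forall fun z (hz : 0 < z) => ?_))).trans (le_of_eq ?_)
  · rw [norm_mul, add_comm z y]
    calc _ ≤ (2 * Real.exp 2 * (1 + |u|) ^ 2) *
          (2 * Real.exp 2 * (1 + |y|) ^ 2 * Real.exp (-(1 + |y|)⁻¹ * z)) :=
          mul_le_mul (ha.norm_add_le u hz.le) (hasAiryBound_airyA.2 y z) (norm_nonneg _)
            (by positivity)
      _ = _ := by ring
  · rw [integral_const_mul, integral_exp_mul_Ioi hneg, mul_zero, Real.exp_zero]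
    have : 0 < 1 + |y| := by positivity
    field_simp

theorem stronglyMeasurable_airyPairing :
    StronglyMeasurable fun p : ℝ × ℝ => airyPairing a p.1 p.2 := by
  refine StronglyMeasurable.integral_prod_right'
    (f := fun q : (ℝ × ℝ) × ℝ => a (q.1.1 + q.2) * airyA (q.2 + q.1.2)) ?_
  refine Measurable.stronglyMeasurable ?_
  exact (ha.1.comp (by fun_prop)).mul (hasAiryBound_airyA.1.comp (by fun_prop))

end HasAiryBound

/-- Near `u` the factor `A'(v+z)` is bounded uniformly for `z > 0`, while `A(z+y)`, which does not
involve `v`, supplies an integrable majorant. -/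
theorem hasDerivAt_airyPairing (u y : ℝ) :
    HasDerivAt (fun u => airyPairing airyA u y) (airyPairing (deriv airyA) u y) u := by
  have hA := hasAiryBound_airyA
  have hA' := hasAiryBound_deriv_airyA
  have hneg : -(1 + |y|)⁻¹ < 0 := neg_lt_zero.2 (by positivity)
  refine (hasDerivAt_integral_of_dominated_loc_of_deriv_le (s := Metric.ball u 1)
    (F := fun v z => airyA (v + z) * airyA (z + y))
    (F' := fun v z => deriv airyA (v + z) * airyA (z + y))
    (bound := fun z => (2 * Real.exp 2 * (1 + (|u| + 1)) ^ 2) *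
      (2 * Real.exp 2 * (1 + |y|) ^ 2) * Real.exp (-(1 + |y|)⁻¹ * z))
    (Metric.ball_mem_nhds u one_pos) ?_ (hA.integrableOn u y) ?_ ?_ ?_ ?_).2
  · exact Eventually.of_forall fun v => (hA.integrableOn v y).1
  · exact (hA'.integrableOn u y).1
  · refine (ae_restrict_iff' measurableSet_Ioi).2
      (Eventually.of_forall fun z (hz : 0 < z) v hv => ?_)
    rw [norm_mul, add_comm z y, mul_assoc]
    have h1 : |v| ≤ |u| + 1 := by
      rw [Metric.mem_ball, Real.dist_eq] at hv
      linarith [abs_sub_abs_le_abs_sub v u]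
    refine mul_le_mul ((hA'.norm_add_le v hz.le).trans ?_) (hA.2 y z) (norm_nonneg _)
      (by positivity)
    gcongr
  · exact (integrableOn_exp_mul_Ioi hneg 0).const_mul _
  · refine Eventually.of_forall fun z v _ => HasDerivAt.mul_const ?_ _
    simpa using (differentiable_airyA (v + z)).hasDerivAt.comp_add_const v z

/-! ### Schwartz weights and the Hilbert–Schmidt factorization -/

theorem SchwartzMap.exists_pow_mul_norm_le (φ : 𝓢(ℝ, ℂ)) (n : ℕ) :
    ∃ K : ℝ, 0 ≤ K ∧ ∀ u, (1 + |u|) ^ n * ‖φ u‖ ≤ K * (1 + u ^ 2)⁻¹ := by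
  -- The two powers beyond `n` pay for `1 + u² ≤ (1 + |u|)²`.
  refine ⟨2 ^ (n + 2) * ((Finset.Iic (n + 2, 0)).sup fun m => SchwartzMap.seminorm ℂ m.1 m.2) φ,
    by positivity, fun u => ?_⟩
  have h := SchwartzMap.one_add_le_sup_seminorm_apply (𝕜 := ℂ) (m := (n + 2, 0)) le_rfl le_rfl φ u
  rw [norm_iteratedFDeriv_zero, Real.norm_eq_abs] at h
  rw [← div_eq_mul_inv, le_div_iff₀ (by positivity)]
  refine le_trans ?_ h
  rw [pow_add, mul_right_comm]
  gcongr
  nlinarith [sq_abs u, abs_nonneg u]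

/-- Integrating in `y` first, the contraction bound leaves `(1+|u|)⁵`, which the decay of `ψ`
absorbs. -/
theorem HasAiryBound.memLp_schwartz_mul_airyPairing {a : ℝ → ℂ} (ha : HasAiryBound a)
    (ψ : 𝓢(ℝ, ℂ)) :
    MemLp (fun p : ℝ × ℝ => ψ p.1 * airyPairing a p.1 p.2) 2 (volume.prod volume) := by
  have hm : AEStronglyMeasurable (fun p : ℝ × ℝ => ψ p.1 * airyPairing a p.1 p.2)
      (volume.prod volume) :=
    ((ψ.continuous.comp continuous_fst).stronglyMeasurable.mul
      ha.stronglyMeasurable_airyPairing).aestronglyMeasurable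
  obtain ⟨K, hK0, hK⟩ := ψ.exists_pow_mul_norm_le 5
  refine (memLp_two_iff_lintegral hm).2 ?_
  rw [lintegral_prod _ (by exact hm.enorm.pow_const 2)]
  refine lt_of_le_of_lt (lintegral_mono (g := fun u => ENNReal.ofReal
    ((2 * Real.exp 2) ^ 2 * K ^ 2 * (1 + u ^ 2)⁻¹)) fun u => ?_)
    (integrable_inv_one_add_sq.const_mul _).lintegral_lt_top
  simp only [enorm_mul, mul_pow]
  rw [lintegral_const_mul' _ _ (by simp)]
  refine (mul_le_mul_right (ha.lintegral_enorm_airyPairing_sq_le u) _).trans ?_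
  rw [← ofReal_norm, ← ENNReal.ofReal_pow (norm_nonneg _), ← ENNReal.ofReal_mul (by positivity)]
  refine ENNReal.ofReal_le_ofReal ?_
  have h1 : (1 + u ^ 2)⁻¹ ≤ 1 := inv_le_one_of_one_le₀ (by nlinarith)
  have h2 : 0 ≤ (1 + u ^ 2)⁻¹ := by positivity
  have h3 : (1 + |u|) ^ 5 * ‖ψ u‖ ^ 2 ≤ K ^ 2 * (1 + u ^ 2)⁻¹ := by
    calc (1 + |u|) ^ 5 * ‖ψ u‖ ^ 2 ≤ (1 + |u|) ^ 10 * ‖ψ u‖ ^ 2 := by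
          gcongr
          · linarith [abs_nonneg u]
          · norm_num
      _ = ((1 + |u|) ^ 5 * ‖ψ u‖) ^ 2 := by ring
      _ ≤ (K * (1 + u ^ 2)⁻¹) ^ 2 := by
          exact pow_le_pow_left₀ (by positivity) (hK u) 2
      _ = K ^ 2 * ((1 + u ^ 2)⁻¹ * (1 + u ^ 2)⁻¹) := by ring
      _ ≤ K ^ 2 * (1 + u ^ 2)⁻¹ := by
          gcongr
          exact mul_le_of_le_one_right h2 h1
  calc ‖ψ u‖ ^ 2 * ((2 * Real.exp 2) ^ 2 * (1 + |u|) ^ 5)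
      = (2 * Real.exp 2) ^ 2 * ((1 + |u|) ^ 5 * ‖ψ u‖ ^ 2) := by ring
    _ ≤ (2 * Real.exp 2) ^ 2 * (K ^ 2 * (1 + u ^ 2)⁻¹) := by gcongr
    _ = _ := by ring

theorem HasAiryBound.exists_norm_schwartz_mul_airyPairing_le {a : ℝ → ℂ} (ha : HasAiryBound a)
    (ψ : 𝓢(ℝ, ℂ)) (y : ℝ) : ∃ K, ∀ u, ‖ψ u * airyPairing a u y‖ ≤ K * (1 + u ^ 2)⁻¹ := by
  obtain ⟨K, hK0, hK⟩ := ψ.exists_pow_mul_norm_le 2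
  refine ⟨(2 * Real.exp 2) ^ 2 * (1 + |y|) ^ 3 * K, fun u => ?_⟩
  rw [norm_mul]
  calc ‖ψ u‖ * ‖airyPairing a u y‖
      ≤ ‖ψ u‖ * ((2 * Real.exp 2) ^ 2 * (1 + |y|) ^ 3 * (1 + |u|) ^ 2) := by
        gcongr
        exact ha.norm_airyPairing_le u y
    _ = (2 * Real.exp 2) ^ 2 * (1 + |y|) ^ 3 * ((1 + |u|) ^ 2 * ‖ψ u‖) := by ring
    _ ≤ (2 * Real.exp 2) ^ 2 * (1 + |y|) ^ 3 * (K * (1 + u ^ 2)⁻¹) := by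
        exact mul_le_mul_of_nonneg_left (hK u) (by positivity)
    _ = _ := by ring

theorem HasAiryBound.integrable_schwartz_mul_airyPairing {a : ℝ → ℂ} (ha : HasAiryBound a)
    (ψ : 𝓢(ℝ, ℂ)) (y : ℝ) : Integrable fun u => ψ u * airyPairing a u y := by
  obtain ⟨K, hK⟩ := ha.exists_norm_schwartz_mul_airyPairing_le ψ y
  refine (integrable_inv_one_add_sq.const_mul K).mono' ?_ (Eventually.of_forall hK)
  exact ψ.continuous.aestronglyMeasurable.mul
    (ha.stronglyMeasurable_airyPairing.comp_measurable measurable_prodMk_right).aestronglyMeasurable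

/-- The fundamental theorem of calculus on `(-∞, x]` for `φ(u) ∫_0^∞ A(u + z) A(z + y) dz`. -/
theorem integral_Iic_deriv_schwartz_mul_airyPairing (φ : 𝓢(ℝ, ℂ)) (x y : ℝ) :
    ∫ u in Set.Iic x, (SchwartzMap.derivCLM ℂ ℂ φ u * airyPairing airyA u y +
      φ u * airyPairing (deriv airyA) u y) = φ x * airyPairing airyA x y := by
  have hd : ∀ u, HasDerivAt (fun u => φ u * airyPairing airyA u y)
      (SchwartzMap.derivCLM ℂ ℂ φ u * airyPairing airyA u y +
        φ u * airyPairing (deriv airyA) u y) u := fun u => by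
    rw [SchwartzMap.derivCLM_apply]
    exact (φ.differentiableAt (x := u)).hasDerivAt.mul (hasDerivAt_airyPairing u y)
  have hlim : Tendsto (fun u => φ u * airyPairing airyA u y) atBot (𝓝 0) := by
    obtain ⟨K, hK⟩ := hasAiryBound_airyA.exists_norm_schwartz_mul_airyPairing_le φ y
    refine squeeze_zero_norm hK ?_
    rw [← mul_zero K]
    refine Tendsto.const_mul K (tendsto_inv_atTop_zero.comp ?_)
    refine tendsto_atTop_add_const_left _ _ ?_
    simpa [Function.comp_def] using
      (tendsto_pow_atTop (α := ℝ) two_ne_zero).comp tendsto_abs_atBot_atTop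
  have h := integral_Iic_of_hasDerivAt_of_tendsto (a := x) (hd x).continuousAt.continuousWithinAt
    (fun u _ => hd u) ((hasAiryBound_airyA.integrable_schwartz_mul_airyPairing _ y).add
      (hasAiryBound_deriv_airyA.integrable_schwartz_mul_airyPairing φ y)).integrableOn hlim
  rw [h, sub_zero]

/-- Multiplication of a Schwartz function by `1 + u ^ 2`. -/
noncomputable def SchwartzMap.mulOneAddSq (φ : 𝓢(ℝ, ℂ)) : 𝓢(ℝ, ℂ) :=
  SchwartzMap.smulLeftCLM ℂ (fun u : ℝ => 1 + u ^ 2) φ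

theorem SchwartzMap.mulOneAddSq_apply (φ : 𝓢(ℝ, ℂ)) (u : ℝ) :
    φ.mulOneAddSq u = ((1 + u ^ 2 : ℝ) : ℂ) * φ u := by
  rw [mulOneAddSq, SchwartzMap.smulLeftCLM_apply_apply (by fun_prop), Complex.real_smul]

/-- A Hilbert–Schmidt kernel with range in the functions having an integrable derivative. -/
noncomputable def weightedPrimitiveKernel (p : ℝ × ℝ) : ℂ :=
  (Set.Iic p.1).indicator (fun u : ℝ => (((1 + p.1 ^ 2)⁻¹ * (1 + u ^ 2)⁻¹ : ℝ) : ℂ)) p.2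

theorem memLp_weightedPrimitiveKernel :
    MemLp weightedPrimitiveKernel 2 ((volume : Measure ℝ).prod (volume : Measure ℝ)) := by
  have hm : Measurable weightedPrimitiveKernel := by
    have h1 : MeasurableSet {p : ℝ × ℝ | p.2 ≤ p.1} :=
      measurableSet_le measurable_snd measurable_fst
    have h2 : Measurable fun p : ℝ × ℝ =>
      (((1 + p.1 ^ 2)⁻¹ * (1 + p.2 ^ 2)⁻¹ : ℝ) : ℂ) := by fun_prop
    exact h2.indicator h1
  refine (memLp_two_iff_integrable_sq_norm hm.aestronglyMeasurable).2 ?_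
  refine (integrable_inv_one_add_sq.mul_prod integrable_inv_one_add_sq).mono'
    (by fun_prop) (Eventually.of_forall fun p => ?_)
  rw [Real.norm_of_nonneg (by positivity)]
  have h1 : ‖weightedPrimitiveKernel p‖ ≤ (1 + p.1 ^ 2)⁻¹ * (1 + p.2 ^ 2)⁻¹ := by
    refine (norm_indicator_le_norm_self _ _).trans ?_
    rw [Complex.norm_real, Real.norm_of_nonneg (by positivity)]
  -- A majorant at most `1` dominates its own square, so its integrability suffices.
  have h2 : (1 + p.1 ^ 2)⁻¹ * (1 + p.2 ^ 2)⁻¹ ≤ 1 :=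
    mul_le_one₀ (inv_le_one_of_one_le₀ (by nlinarith)) (by positivity)
      (inv_le_one_of_one_le₀ (by nlinarith))
  nlinarith [norm_nonneg (weightedPrimitiveKernel p)]

/-- The weighted derivative in the first variable of `φ(u) ∫_0^∞ A(u + z) A(z + y) dz`. -/
noncomputable def airyDerivKernel (φ : 𝓢(ℝ, ℂ)) (p : ℝ × ℝ) : ℂ :=
  (SchwartzMap.derivCLM ℂ ℂ φ).mulOneAddSq p.1 * airyPairing airyA p.1 p.2 +
    φ.mulOneAddSq p.1 * airyPairing (deriv airyA) p.1 p.2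

theorem memLp_airyDerivKernel (φ : 𝓢(ℝ, ℂ)) :
    MemLp (airyDerivKernel φ) 2 ((volume : Measure ℝ).prod (volume : Measure ℝ)) :=
  (hasAiryBound_airyA.memLp_schwartz_mul_airyPairing _).add
    (hasAiryBound_deriv_airyA.memLp_schwartz_mul_airyPairing _)

/-- There are two weights to undo: the `1 + u²` outside the derivative cancels against `(1+u²)⁻¹`,
and the one inside it survives the fundamental theorem of calculus as `1 + x²`, cancelling
`(1+x²)⁻¹`. -/
theorem integral_weightedPrimitiveKernel_mul (φ : 𝓢(ℝ, ℂ)) (x y : ℝ) :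
    ∫ u, weightedPrimitiveKernel (x, u) * airyDerivKernel φ.mulOneAddSq (u, y) =
      φ x * airyPairing airyA x y := by
  have hne : ∀ u : ℝ, (1 : ℂ) + (u : ℂ) ^ 2 ≠ 0 := fun u => by
    have : (0 : ℝ) < 1 + u ^ 2 := by positivity
    exact_mod_cast this.ne'
  have h1 : ∀ u, weightedPrimitiveKernel (x, u) * airyDerivKernel φ.mulOneAddSq (u, y) =
      (Set.Iic x).indicator (fun u => (((1 + x ^ 2)⁻¹ : ℝ) : ℂ) *
        (SchwartzMap.derivCLM ℂ ℂ φ.mulOneAddSq u * airyPairing airyA u y +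
          φ.mulOneAddSq u * airyPairing (deriv airyA) u y)) u := fun u => by
    by_cases hu : u ∈ Set.Iic x
    · rw [weightedPrimitiveKernel, Set.indicator_of_mem hu, Set.indicator_of_mem hu,
        airyDerivKernel, SchwartzMap.mulOneAddSq_apply, φ.mulOneAddSq.mulOneAddSq_apply]
      have := hne u
      push_cast
      field_simp
    · rw [weightedPrimitiveKernel, Set.indicator_of_notMem hu, Set.indicator_of_notMem hu, zero_mul]
  simp_rw [h1]
  rw [integral_indicator measurableSet_Iic, integral_const_mul,
    integral_Iic_deriv_schwartz_mul_airyPairing, SchwartzMap.mulOneAddSq_apply]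
  have := hne x
  push_cast
  field_simp

theorem corollary3p3 (f : 𝓢(ℝ, ℂ)) (α : ℝ) (hα : 0 < α) :
    (∀ x : ℝ, Tendsto (airyTruncated x) (atBot ×ˢ atTop) (𝓝 (airyA x))) ∧
    (∀ x y : ℝ, IntegrableOn (fun z : ℝ => airyA (x + z) * airyA (z + y)) (Set.Ioi 0)) ∧
    ∃ T : Lp ℂ 2 (volume : Measure ℝ) →L[ℂ] Lp ℂ 2 (volume : Measure ℝ),
      IsIntegralOperator (airyKernel α f) T ∧ IsTraceClass T := by
  refine ⟨fun x => ?_, fun x y => hasAiryBound_airyA.integrableOn x y, ?_⟩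
  · rw [airyA_eq_integral one_pos]
    exact tendsto_airyTruncated one_pos x
  set φ : 𝓢(ℝ, ℂ) := SchwartzMap.compCLMOfContinuousLinearEquiv ℂ
    (ContinuousLinearEquiv.unitsEquivAut ℝ (Units.mk0 α⁻¹ (inv_ne_zero hα.ne'))) f with hφ
  have hφx : ∀ x, φ x = f (x / α) := fun x => by
    simp [hφ, div_eq_mul_inv]
  have hk : ∀ x y, airyKernel α f x y =
      ∫ u, weightedPrimitiveKernel (x, u) * airyDerivKernel φ.mulOneAddSq (u, y) := fun x y => by
    rw [integral_weightedPrimitiveKernel_mul, hφx]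
    rfl
  refine ⟨kernelOperator _ memLp_weightedPrimitiveKernel ∘L
    kernelOperator _ (memLp_airyDerivKernel φ.mulOneAddSq), fun g => ?_, ?_⟩
  · simp_rw [hk]
    exact kernelOperator_comp_ae _ _ g
  · exact isTraceClass_comp _ _
      (fun _ b => hilbertSchmidtSq_kernelOperator_ne_top _ memLp_weightedPrimitiveKernel b)
      (fun _ b => hilbertSchmidtSq_kernelOperator_ne_top _ (memLp_airyDerivKernel _) b)
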